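/- **Theorem 3.1.** Let $\{X_t\}_{t=0}^\infty$ be a weakly stationary $q$-dimensional process with spectral density matrix $f=(f_{rs})$, i.e. $f$ is integrable on $(-\pi,\pi)$ and $\mathbb E[(X_t-\mathbb EX_t)(X_u-\mathbb EX_u)']=\int_{-\pi}^{\pi}e^{i(u-t)\lambda}f(\lambda)\,d\lambda$ for all $t,u\ge 0$. Let $G_0=(G_0^{rs})$ be a real symmetric positive definite $q\times q$ matrix, $d_0=(d_1^0,\dots,d_q^0)\in\mathbb R^q$, and $m=m(n)$ a sequence of natural numbers. Write $\lambda_j=2\pi j/n$, and let $\|\cdot\|_\infty$ be the largest modulus of the entries of a vector or matrix. Assume: * **A1.** $f_{rs}(\lambda)=e^{i\pi(d_r^0-d_s^0)/2}G_0^{rs}\lambda^{-d_r^0-d_s^0}+o(\lambda^{-d_r^0-d_s^0})$ as $\lambda\to0^+$, for all $r,s$. * **A2.** $X_t-\mathbb E X_t=\sum_{k\ge0}A_k\varepsilon_{t-k}$ (in mean square), where the $A_k$ are real matrices with $\sum_k\|A_k\|_\infty^2<\infty$ and $\{\varepsilon_t\}_{t\in\mathbb Z}$ is square integrable with $\mathbb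 E(\varepsilon_t\mid\mathcal F_{t-1})=0$ and $\mathbb E(\varepsilon_t\varepsilon_t'\mid\mathcal F_{t-1})=I_q$ a.s. for all $t\in\mathbb Z$, $\mathcal F_t$ being the $\sigma$-field generated by $\{\varepsilon_s:s\le t\}$. Moreover there are a random variable $\xi$ with $\mathbb E\xi^2<\infty$ and a constant $K>0$ with $\mathbb P(\|\varepsilon_t\|_\infty^2>\eta)\le K\,\mathbb P(\xi^2>\eta)$ for all $t$ and all $\eta>0$. * **A3.** The function $A(\lambda)=\sum_{k\ge0}A_ke^{ik\lambda}$ (series in $L^2(-\pi,\pi)$) has a version that is differentiable on some interval $(0,\delta)$, $\delta>0$, and such that each row $a_r(\lambda)$ of its conjugate transpose $\overline{A(\lambda)}'$ satisfies $\frac{d}{d\lambda}a_r(\lambda)=O\big(\lambda^{-1}\|a_r(\lambda)\|_\infty\big)$ as $\lambda\to0^+$. * **A4.** $1/m+m/n\to0$ as $n\to\infty$. Let $\beta\in[0,1]$, let $B\subseteq\mathbb R^q$ be closed, put $$\Omega_\beta=\big[-\tfrac\beta2,0\big]^q\cap\big(-\tfrac12,0\big]^q\cap B ,$$ and assume $d_0\in\Omega_\beta$.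 For each $n$ let $f_n$ be an estimator of $f$ based on $X_1,\dots,X_n$ which is $n^\beta$-consistent, uniformly over the Fourier frequencies $\lambda_1,\dots,\lambda_m$: $$n^\beta\max_{1\le j\le m}\|f_n(\lambda_j)-f(\lambda_j)\|_\infty\overset{\mathbb P}{\longrightarrow}0\qquad(n\to\infty).$$ Define $$\widehat G(d)=\frac1m\sum_{j=1}^m\mathrm{Re}\Big[\mathrm{diag}_{i}\{\lambda_j^{d_i}\}\,f_n(\lambda_j)\,\mathrm{diag}_{i}\{\lambda_j^{d_i}\}\Big],\qquad S(d)=\log\det\widehat G(d)-2\sum_{k=1}^qd_k\,\frac1m\sum_{j=1}^m\log\lambda_j ,$$ and let $\widehat d=\widehat d_n$ be a minimiser of $S$ over $\Omega_\beta$ (for every sample for which a minimiser exists; arbitrary otherwise). Then $\widehat d\overset{\mathbb P}{\longrightarrow}d_0$ as $n\to\infty$. -/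

import Mathlib

open MeasureTheory ProbabilityTheory Filter Topology Asymptotics

namespace LongMemory

noncomputable section

/-- The sup-norm of a matrix: the largest modulus of an entry. -/
def supNorm {𝕜 : Type*} [RCLike 𝕜] {q : ℕ} (M : Matrix (Fin q) (Fin q) 𝕜) : ℝ :=
  ‖(fun r s => M r s : Fin q → Fin q → 𝕜)‖

/-- The Fourier frequency `2πj/n`. -/
def fourierFreq (n j : ℕ) : ℝ := 2 * Real.pi * j / n

/-- Weak stationarity of an `ℝ^q`-valued sequence: finite second moments, constant mean, and
covariances that depend on the lag only. -/
structure WeaklyStationary {Ω : Type*} [MeasurableSpace Ω] (μ : Measure Ω) {q : ℕ}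
    (X : ℕ → Ω → Fin q → ℝ) : Prop where
  memLp : ∀ t, MemLp (X t) 2 μ
  mean : ∀ t, ∫ ω, X t ω ∂μ = ∫ ω, X 0 ω ∂μ
  cov : ∀ t h r s, cov[fun ω => X t ω r, fun ω => X (t + h) ω s; μ]
    = cov[fun ω => X 0 ω r, fun ω => X h ω s; μ]

/-- `f` is a spectral density matrix of `X`: it is integrable on `(-π, π)` and
`E[(X_t - E X_t)(X_u - E X_u)'] = ∫_{-π}^{π} e^{i(u-t)x} f(x) dx`. -/
structure IsSpectralDensity {Ω : Type*} [MeasurableSpace Ω] (μ : Measure Ω) {q : ℕ}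
    (X : ℕ → Ω → Fin q → ℝ) (f : ℝ → Matrix (Fin q) (Fin q) ℂ) : Prop where
  integrable : ∀ r s, IntervalIntegrable (fun x => f x r s) volume (-Real.pi) Real.pi
  cov_eq : ∀ (t u : ℕ) (r s : Fin q),
    ((cov[fun ω => X t ω r, fun ω => X u ω s; μ] : ℝ) : ℂ)
      = ∫ x in (-Real.pi)..Real.pi,
          Complex.exp (Complex.I * (((u : ℝ) - (t : ℝ)) * x : ℝ)) * f x r s

/-- Assumption A1: behaviour of the spectral density matrix at the origin,
`f_{rs}(x) = e^{iπ(d_r - d_s)/2} G_{rs} x^{-d_r-d_s} + o(x^{-d_r-d_s})` as `x → 0⁺`. -/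
def AssumptionA1 {q : ℕ} (f : ℝ → Matrix (Fin q) (Fin q) ℂ)
    (G₀ : Matrix (Fin q) (Fin q) ℝ) (d₀ : Fin q → ℝ) : Prop :=
  ∀ r s, (fun x : ℝ => f x r s
      - Complex.exp (Complex.I * (Real.pi * (d₀ r - d₀ s) / 2 : ℝ)) * (G₀ r s : ℂ)
        * ((x ^ (-d₀ r - d₀ s) : ℝ) : ℂ))
    =o[𝓝[>] (0 : ℝ)] fun x : ℝ => x ^ (-d₀ r - d₀ s)

/-- The σ-field generated by the innovations `ε_s`, `s ≤ t`. -/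
@[reducible]
def past {Ω : Type*} {q : ℕ} (ε : ℤ → Ω → Fin q → ℝ) (t : ℤ) : MeasurableSpace Ω :=
  ⨆ s : ℤ, ⨆ _ : s ≤ t, MeasurableSpace.comap (ε s) inferInstance

/-- Assumption A2: `X` is a causal linear sequence `X_t - E X_t = ∑_{k ≥ 0} A_k ε_{t-k}` (the
series converging in mean square) with square-summable coefficients, driven by square integrable
martingale differences with conditional covariance matrix `I_q`, uniformly dominated in
probability by a square integrable random variable. -/
structure AssumptionA2 {Ω : Type*} [MeasurableSpace Ω] (μ : Measure Ω) {q : ℕ}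
    (X : ℕ → Ω → Fin q → ℝ) (A : ℕ → Matrix (Fin q) (Fin q) ℝ)
    (ε : ℤ → Ω → Fin q → ℝ) : Prop where
  summable : Summable fun k => supNorm (A k) ^ 2
  linear : ∀ t : ℕ, Tendsto (fun N : ℕ =>
      eLpNorm (fun ω => X t ω - (∫ ω', X t ω' ∂μ)
        - ∑ k ∈ Finset.range N, (A k).mulVec (ε ((t : ℤ) - (k : ℤ)) ω)) 2 μ) atTop (𝓝 0)
  measurable : ∀ t, Measurable (ε t)
  memLp : ∀ t, MemLp (ε t) 2 μ
  condMean : ∀ t, μ[ε t | past ε (t - 1)] =ᵐ[μ] 0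
  condCov : ∀ t r s, μ[fun ω => ε t ω r * ε t ω s | past ε (t - 1)]
    =ᵐ[μ] fun _ => (1 : Matrix (Fin q) (Fin q) ℝ) r s
  dominated : ∃ (ξ : Ω → ℝ) (K : ℝ), MemLp ξ 2 μ ∧ 0 < K ∧
    ∀ t : ℤ, ∀ η : ℝ, 0 < η →
      μ.real {ω | η < ‖ε t ω‖ ^ 2} ≤ K * μ.real {ω | η < ξ ω ^ 2}

/-- `𝒜` is (a version of) the function `A(x) = ∑_{k ≥ 0} A_k e^{ikx}`. As the coefficients are
only square-summable, the series is understood in `L²(-π, π)`. -/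
def IsTransferFunction {q : ℕ} (A : ℕ → Matrix (Fin q) (Fin q) ℝ)
    (𝒜 : ℝ → Matrix (Fin q) (Fin q) ℂ) : Prop :=
  ∀ r s, Tendsto (fun N : ℕ =>
    eLpNorm (fun x : ℝ => 𝒜 x r s
        - ∑ k ∈ Finset.range N, (A k r s : ℂ) * Complex.exp (Complex.I * ((k : ℝ) * x : ℝ)))
      2 (volume.restrict (Set.Ioc (-Real.pi) Real.pi))) atTop (𝓝 0)

/-- Assumption A3: near the origin `A(x)` is differentiable, and the derivative of each row of its
conjugate transpose is `O(x⁻¹ ‖row‖_∞)` as `x → 0⁺`. -/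
def AssumptionA3 {q : ℕ} (A : ℕ → Matrix (Fin q) (Fin q) ℝ) : Prop :=
  ∃ 𝒜 : ℝ → Matrix (Fin q) (Fin q) ℂ, IsTransferFunction A 𝒜 ∧
    (∃ δ : ℝ, 0 < δ ∧ ∀ r s, ∀ x ∈ Set.Ioo 0 δ, DifferentiableAt ℝ (fun y => 𝒜 y r s) x) ∧
    ∀ r : Fin q, (fun x : ℝ => deriv (fun y : ℝ => ((𝒜 y).conjTranspose r : Fin q → ℂ)) x)
      =O[𝓝[>] (0 : ℝ)] fun x : ℝ => x⁻¹ * ‖((𝒜 x).conjTranspose r : Fin q → ℂ)‖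

/-- Assumption A4: `1/m + m/n → 0`, that is, `m → ∞` and `m/n → 0`. -/
def AssumptionA4 (m : ℕ → ℕ) : Prop :=
  Tendsto m atTop atTop ∧ Tendsto (fun n => (m n : ℝ) / (n : ℝ)) atTop (𝓝 0)

/-- The value at the sample `X_1, …, X_n` of an estimator `fn` of the spectral density matrix. -/
def estimate {Ω : Type*} {q : ℕ} (X : ℕ → Ω → Fin q → ℝ)
    (fn : (n : ℕ) → (Fin n → Fin q → ℝ) → ℝ → Matrix (Fin q) (Fin q) ℂ) (n : ℕ) (ω : Ω) :
    ℝ → Matrix (Fin q) (Fin q) ℂ :=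
  fn n fun i => X (i + 1) ω

/-- `n^β`-consistency, `n^β (f_n - f) → 0` in probability, uniformly over the Fourier frequencies
`2πj/n`, `1 ≤ j ≤ m`: for every `η > 0` the probability that
`max_{1 ≤ j ≤ m} n^β ‖f_n(2πj/n) - f(2πj/n)‖_∞ ≥ η` tends to `0`. -/
def IsRateConsistent {Ω : Type*} [MeasurableSpace Ω] (μ : Measure Ω) {q : ℕ}
    (β : ℝ) (m : ℕ → ℕ) (f : ℝ → Matrix (Fin q) (Fin q) ℂ)
    (fhat : ℕ → Ω → ℝ → Matrix (Fin q) (Fin q) ℂ) : Prop :=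
  ∀ η : ℝ, 0 < η → Tendsto (fun n : ℕ => μ {ω | ∃ j ∈ Finset.Icc 1 (m n),
    η ≤ (n : ℝ) ^ β * supNorm (fhat n ω (fourierFreq n j) - f (fourierFreq n j))})
    atTop (𝓝 0)

/-- The matrix `Ĝ(d) = m⁻¹ ∑_{j=1}^m Re[diag(λ_j^{d_i}) F(λ_j) diag(λ_j^{d_i})]`, with
`λ_j = 2πj/n`. -/
def Ghat {q : ℕ} (n m : ℕ) (F : ℝ → Matrix (Fin q) (Fin q) ℂ) (d : Fin q → ℝ) :
    Matrix (Fin q) (Fin q) ℝ :=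
  (m : ℝ)⁻¹ • ∑ j ∈ Finset.Icc 1 m,
    (Matrix.diagonal (fun i => ((fourierFreq n j ^ d i : ℝ) : ℂ)) * F (fourierFreq n j)
      * Matrix.diagonal (fun i => ((fourierFreq n j ^ d i : ℝ) : ℂ))).map Complex.re

/-- The objective function
`S(d) = log det Ĝ(d) - 2 ∑_{k=1}^q d_k m⁻¹ ∑_{j=1}^m log λ_j`. -/
def objective {q : ℕ} (n m : ℕ) (F : ℝ → Matrix (Fin q) (Fin q) ℂ) (d : Fin q → ℝ) : ℝ :=
  Real.log (Ghat n m F d).det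
    - 2 * ∑ k, d k * ((m : ℝ)⁻¹ * ∑ j ∈ Finset.Icc 1 m, Real.log (fourierFreq n j))

/-- The parameter set `Ω_β = [-β/2, 0]^q ∩ (-1/2, 0]^q ∩ B`. -/
def paramSet {q : ℕ} (β : ℝ) (B : Set (Fin q → ℝ)) : Set (Fin q → ℝ) :=
  (Set.univ.pi fun _ => Set.Icc (-β / 2) 0) ∩ (Set.univ.pi fun _ => Set.Ioc (-1 / 2) 0) ∩ B

/-- `dhat` is a minimiser of `S` over `Θ`: its value is a point of `Θ` at which `S` is minimal,
for every sample for which there is such a point. -/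
def IsArgminEstimator {Ω : Type*} {q : ℕ} (Θ : Set (Fin q → ℝ))
    (S : ℕ → Ω → (Fin q → ℝ) → ℝ) (dhat : ℕ → Ω → Fin q → ℝ) : Prop :=
  ∀ n ω, (∃ d ∈ Θ, IsMinOn (S n ω) Θ d) → dhat n ω ∈ Θ ∧ IsMinOn (S n ω) Θ (dhat n ω)

end

end LongMemory

/-!
The proof compares `S(d)` with `S(d₀)` for a fixed sample, on the event of the rate assumption where
all estimation errors at the Fourier frequencies are small.

Put `θ = d - d₀` and `P = (cos(π(d_r⁰ - d_s⁰)/2) G₀^{rs})`, which is positive definite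
(`posDef_phaseMatrix`). Dividing row and column `r` of `Ĝ(d)` by `λ_m^{θ_r}` and by the root mean
square of `(j/m)^{θ_r}` leaves a matrix that is uniformly close to the Hadamard product `C ⊙ P`,
where `C` is the correlation matrix of the functions `j ↦ (j/m)^{θ_r}` (`abs_normGhat_sub_le`).
The errors stay small because `d` and `d₀` lie in `[-β/2, 0]^q`: the weight of an error of size
`n^{-β}` is at most `n^β` (`weight_le`). By Oppenheim's inequality `det (C ⊙ P) ≥ det P`
(`det_hadamard_ge`), with equality at `θ = 0`, so up to small errors
`S(d) - S(d₀) ≥ ∑_k log (m⁻¹ ∑_j exp (2 θ_k (x_j - x̄)))` with `x_j = log (j/m)` and `x̄` their mean.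
Each summand is nonnegative by `1 + y ≤ exp y`, and it is bounded below by a positive constant,
uniformly in `m`, when `θ_k` is bounded away from zero, since a fixed proportion of the `x_j` is
away from `x̄` (`exists_gap_expMoment`).

These bounds hold on the whole closed box, also on the face `d_r = -1/2`, where the power means may
diverge as `m` grows, so that face needs no separate treatment. They also give existence: `S` is
continuous on the compact set `[-β/2, 0]^q ∩ B`, and its minimiser there is close to `d₀`, hence off
the excluded face and in `Ω_β` (`exists_isMinOn_and_dist_lt`).
-/

namespace LongMemory

/-! ### Oppenheim's inequality and perturbation of determinants -/

/-- Subtracting `det A / det A₁` from the corner entry, where `A₁` is the complementary principal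
submatrix, is the largest reduction that keeps a positive definite matrix positive semidefinite. -/
theorem posSemidef_sub_single_corner {n : ℕ} {A : Matrix (Fin (n + 1)) (Fin (n + 1)) ℝ}
    (hA : A.PosDef) :
    (A - Matrix.single 0 0 (A.det / (A.submatrix Fin.succ Fin.succ).det)).PosSemidef := by
  set t := A.det / (A.submatrix Fin.succ Fin.succ).det with ht
  have hdet : 0 < A.det := hA.det_pos
  have hsub : 0 < (A.submatrix Fin.succ Fin.succ).det :=
    (hA.submatrix (Fin.succ_injective n)).det_pos
  have htpos : 0 < t := div_pos hdet hsub
  have hinv : A⁻¹ 0 0 = t⁻¹ := by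
    rw [Matrix.inv_def, Matrix.smul_apply, Matrix.adjugate_fin_succ_eq_det_submatrix]
    simp [ht, div_eq_mul_inv, Fin.succAbove_zero, mul_comm]
  have hsymm : A.transpose = A := by simpa using hA.isHermitian.eq
  refine Matrix.PosSemidef.of_dotProduct_mulVec_nonneg ?_ fun x => ?_
  · refine hA.isHermitian.sub ?_
    simp [Matrix.IsHermitian]
  set e : Fin (n + 1) → ℝ := Pi.single 0 1 with he
  set z := A⁻¹.mulVec e with hz
  have hAz : A.mulVec z = e := by
    rw [hz, Matrix.mulVec_mulVec, Matrix.mul_nonsing_inv _ hdet.ne'.isUnit, Matrix.one_mulVec]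
  have hz0 : z 0 = t⁻¹ := by rw [hz, he, Matrix.mulVec_single_one, Matrix.col_apply, hinv]
  have hzA : ∀ y, z ⬝ᵥ A.mulVec y = y 0 := fun y => by
    rw [Matrix.dotProduct_mulVec, ← Matrix.mulVec_transpose, hsymm, hAz, he,
      single_one_dotProduct]
  -- The quadratic form at the `A`-orthogonal projection of `x` off `z = A⁻¹ e₀`.
  have key := hA.posSemidef.dotProduct_mulVec_nonneg (x - (x 0 * t) • z)
  simp only [star_trivial, Matrix.mulVec_sub, Matrix.mulVec_smul, hAz, sub_dotProduct,
    dotProduct_sub, smul_dotProduct, dotProduct_smul, smul_eq_mul] at key ⊢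
  rw [hzA, he, dotProduct_single_one, dotProduct_single_one, hz0] at key
  rw [Matrix.sub_mulVec, dotProduct_sub]
  have h1 : x ⬝ᵥ (Matrix.single 0 0 t).mulVec x = t * x 0 ^ 2 := by
    rw [Matrix.single_mulVec]
    simp [dotProduct, Function.update_apply]
    ring
  rw [h1]
  have : x 0 * t * (x 0 * t * t⁻¹) = t * x 0 ^ 2 := by field_simp
  nlinarith [key]

/-- **Oppenheim's inequality** for the Hadamard product of a positive definite and a positive
semidefinite real matrix. The induction uses that `det (A ⊙ B)` is affine in the corner entry of
`A`, and nonnegative after the reduction of `posSemidef_sub_single_corner` by Schur's theorem. -/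
theorem det_hadamard_ge : ∀ {n : ℕ} {A B : Matrix (Fin n) (Fin n) ℝ}, A.PosDef →
    B.PosSemidef → A.det * ∏ i, B i i ≤ (A.hadamard B).det
  | 0, A, B, _, _ => by simp
  | n + 1, A, B, hA, hB => by
    have ih := det_hadamard_ge (hA.submatrix (Fin.succ_injective n))
      (hB.submatrix Fin.succ)
    have hsub : 0 < (A.submatrix Fin.succ Fin.succ).det :=
      (hA.submatrix (Fin.succ_injective n)).det_pos
    have hdet : 0 < A.det := hA.det_pos
    set t := A.det / (A.submatrix Fin.succ Fin.succ).det with ht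
    have hpos := ((posSemidef_sub_single_corner hA).hadamard hB).det_nonneg
    rw [← ht] at hpos
    have hrow : A.hadamard B = ((A - Matrix.single 0 0 t).hadamard B).updateRow 0
        ((A - Matrix.single 0 0 t).hadamard B 0 + (t * B 0 0) • Pi.single 0 1) := by
      ext i j
      refine Fin.cases ?_ (fun i => ?_) i
      · refine Fin.cases ?_ (fun j => ?_) j <;>
          simp [Matrix.hadamard_apply, (Fin.succ_ne_zero _).symm]
        ring
      · simp [Matrix.hadamard_apply, (Fin.succ_ne_zero _).symm]
    have hexp : (A.hadamard B).det = ((A - Matrix.single 0 0 t).hadamard B).det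
        + t * B 0 0 * ((A.submatrix Fin.succ Fin.succ).hadamard
          (B.submatrix Fin.succ Fin.succ)).det := by
      rw [hrow, Matrix.det_updateRow_add, Matrix.updateRow_eq_self, Matrix.det_updateRow_smul,
        ← Matrix.adjugate_apply, Matrix.adjugate_fin_succ_eq_det_submatrix]
      congr 2
      simp only [Fin.val_zero, add_zero, pow_zero, one_mul, Fin.succAbove_zero]
      congr 1
      ext i j
      simp [Matrix.hadamard_apply, (Fin.succ_ne_zero _).symm]
    rw [hexp, Fin.prod_univ_succ]
    have hB0 : 0 ≤ B 0 0 := hB.diag_nonneg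
    have htpos : 0 < t := div_pos hdet hsub
    have h2 := mul_le_mul_of_nonneg_left ih (mul_nonneg htpos.le hB0)
    have h3 : t * B 0 0 * ((A.submatrix Fin.succ Fin.succ).det
        * ∏ i, (B.submatrix Fin.succ Fin.succ) i i)
        = A.det * (B 0 0 * ∏ i : Fin n, B i.succ i.succ) := by
      simp only [Matrix.submatrix_apply, ht]
      field_simp
    linarith

/-- The determinant is uniformly continuous on bounded sets of matrices. -/
theorem exists_abs_det_sub_lt (q : ℕ) (K : ℝ) {ε : ℝ} (hε : 0 < ε) :
    ∃ κ > 0, ∀ P N : Matrix (Fin q) (Fin q) ℝ, (∀ r s, |P r s| ≤ K) →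
      (∀ r s, |N r s| ≤ κ) → |(P + N).det - P.det| < ε := by
  let D : (Fin q → Fin q → ℝ) → ℝ := fun M => Matrix.det (Matrix.of M)
  have hD : Continuous D := Continuous.matrix_det continuous_id
  have huc : UniformContinuousOn D (Metric.closedBall 0 (|K| + 1)) :=
    (isCompact_closedBall _ _).uniformContinuousOn_of_continuous hD.continuousOn
  obtain ⟨δ, hδ, h⟩ := Metric.uniformContinuousOn_iff.1 huc ε hε
  refine ⟨min (δ / 2) 1, by positivity, fun P N hP hN => ?_⟩
  have hN' : ∀ r s, |N r s| ≤ 1 := fun r s => (hN r s).trans (min_le_right _ _)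
  have hδ2 : ∀ r s, |N r s| ≤ δ / 2 := fun r s => (hN r s).trans (min_le_left _ _)
  have hP' : ∀ r s, |P r s| ≤ |K| := fun r s => (hP r s).trans (le_abs_self _)
  have h0 : (0 : ℝ) ≤ |K| := abs_nonneg K
  have bound : ∀ (F : Fin q → Fin q → ℝ) (c : ℝ), 0 ≤ c → (∀ r s, |F r s| ≤ c) → ‖F‖ ≤ c :=
    fun F c hc hF => (pi_norm_le_iff_of_nonneg hc).2 fun r =>
      (pi_norm_le_iff_of_nonneg hc).2 fun s => hF r s
  refine h (fun r s => (P + N) r s) ?_ (fun r s => P r s) ?_ ?_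
  · rw [mem_closedBall_zero_iff]
    refine bound _ _ (by positivity) fun r s => ?_
    exact (abs_add_le _ _).trans (add_le_add (hP' r s) (hN' r s))
  · rw [mem_closedBall_zero_iff]
    exact bound _ _ (by positivity) fun r s => (hP' r s).trans (by linarith)
  · rw [dist_eq_norm]
    refine (bound _ (δ / 2) (by positivity) fun r s => ?_).trans_lt (by linarith)
    simpa using hδ2 r s

/-! ### The exponential gap of the logarithms of `1/m, …, m/m` -/

theorem add_min_le_exp (y : ℝ) : 1 + y + min (y ^ 2 / 4) 1 ≤ Real.exp y := by
  rcases le_or_gt (-2) y with h | h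
  · have h1 : 1 + y / 2 ≤ Real.exp (y / 2) := by linarith [Real.add_one_le_exp (y / 2)]
    have h2 : Real.exp y = Real.exp (y / 2) ^ 2 := by
      rw [← Real.exp_nat_mul]; congr 1; push_cast; ring
    rw [h2]
    have h3 : (1 + y / 2) ^ 2 ≤ Real.exp (y / 2) ^ 2 := by
      apply pow_le_pow_left₀ (by linarith) h1
    linarith [min_le_left (y ^ 2 / 4) 1]
  · linarith [min_le_right (y ^ 2 / 4) 1, Real.exp_pos y]

/-- The mean of `log (j / M)` over `1 ≤ j ≤ M`. -/
noncomputable def meanLog (M : ℕ) : ℝ :=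
  (M : ℝ)⁻¹ * ∑ j ∈ Finset.Icc 1 M, Real.log (j / M)

/-- The normalised exponential moment of `log (j / M)`, `1 ≤ j ≤ M`, at `t`. -/
noncomputable def expMoment (M : ℕ) (t : ℝ) : ℝ :=
  (M : ℝ)⁻¹ * ∑ j ∈ Finset.Icc 1 M, Real.exp (t * (Real.log (j / M) - meanLog M))

theorem sum_log_sub_meanLog {M : ℕ} (hM : 1 ≤ M) :
    ∑ j ∈ Finset.Icc 1 M, (Real.log (j / M) - meanLog M) = 0 := by
  have : (M : ℝ) ≠ 0 := by positivity
  rw [Finset.sum_sub_distrib, Finset.sum_const, Nat.card_Icc, meanLog]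
  simp
  field_simp
  simp

theorem one_le_expMoment {M : ℕ} (hM : 1 ≤ M) (t : ℝ) : 1 ≤ expMoment M t := by
  have hM' : (0 : ℝ) < M := by positivity
  have h : ∑ j ∈ Finset.Icc 1 M, (1 + t * (Real.log (j / M) - meanLog M))
      ≤ ∑ j ∈ Finset.Icc 1 M, Real.exp (t * (Real.log (j / M) - meanLog M)) :=
    Finset.sum_le_sum fun j _ => by
      linarith [Real.add_one_le_exp (t * (Real.log (j / M) - meanLog M))]
  rw [Finset.sum_add_distrib, ← Finset.mul_sum, sum_log_sub_meanLog hM] at h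
  rw [expMoment, ← div_eq_inv_mul, le_div_iff₀ hM']
  simpa using h

/-- A fixed proportion of the numbers `log (j / M)` lies at distance at least `log 2 / 2` from any
given point, as about a quarter of them are at most `-log 4` and a half at least `-log 2`. -/
theorem card_far_log {M : ℕ} (hM : 8 ≤ M) (x : ℝ) :
    (M : ℝ) / 8 ≤ ((Finset.Icc 1 M).filter
      fun j : ℕ => Real.log 2 / 2 ≤ |Real.log (j / M) - x|).card := by
  have hM0 : (0 : ℝ) < M := by positivity
  have h4 : Real.log (1 / 4) = - (2 * Real.log 2) := by
    rw [one_div, Real.log_inv, show (4 : ℝ) = 2 ^ 2 by norm_num, Real.log_pow]; norm_num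
  have h2 : Real.log (1 / 2) = - Real.log 2 := by rw [one_div, Real.log_inv]
  rcases le_total x (-(3 / 2) * Real.log 2) with hx | hx
  · have hsub : Finset.Icc (M / 2 + 1) M ⊆ (Finset.Icc 1 M).filter
        fun j : ℕ => Real.log 2 / 2 ≤ |Real.log (j / M) - x| := by
      intro j hj
      rw [Finset.mem_Icc] at hj
      rw [Finset.mem_filter, Finset.mem_Icc]
      refine ⟨by omega, ?_⟩
      have hj2 : (M : ℝ) ≤ 2 * j := by exact_mod_cast (by omega : M ≤ 2 * j)
      have : Real.log (1 / 2) ≤ Real.log (j / M) := by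
        apply Real.log_le_log (by norm_num)
        rw [le_div_iff₀ hM0]; linarith
      refine le_trans ?_ (le_abs_self _)
      linarith
    have hc := Finset.card_le_card hsub
    rw [Nat.card_Icc] at hc
    have : M ≤ 8 * (M + 1 - (M / 2 + 1)) := by omega
    rw [div_le_iff₀ (by norm_num)]
    exact_mod_cast (by omega)
  · have hsub : Finset.Icc 1 (M / 4) ⊆ (Finset.Icc 1 M).filter
        fun j : ℕ => Real.log 2 / 2 ≤ |Real.log (j / M) - x| := by
      intro j hj
      rw [Finset.mem_Icc] at hj
      rw [Finset.mem_filter, Finset.mem_Icc]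
      refine ⟨by omega, ?_⟩
      have hj2 : 4 * (j : ℝ) ≤ M := by exact_mod_cast (by omega : 4 * j ≤ M)
      have hj0 : (0 : ℝ) < j := by exact_mod_cast hj.1
      have : Real.log (j / M) ≤ Real.log (1 / 4) := by
        apply Real.log_le_log (by positivity)
        rw [div_le_iff₀ hM0]; linarith
      refine le_trans ?_ (neg_le_abs _)
      linarith
    have hc := Finset.card_le_card hsub
    rw [Nat.card_Icc] at hc
    rw [div_le_iff₀ (by norm_num)]
    exact_mod_cast (by omega)

/-- Away from `t = 0` the normalised exponential moment exceeds `1` by a margin that does not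
depend on `M`. -/
theorem exists_gap_expMoment {η : ℝ} (hη : 0 < η) :
    ∃ ρ > 0, ∀ M : ℕ, 8 ≤ M → ∀ t : ℝ, η ≤ |t| → 1 + ρ ≤ expMoment M t := by
  have hl : 0 < Real.log 2 := Real.log_pos (by norm_num)
  set c := min ((η * (Real.log 2 / 2)) ^ 2 / 4) 1 with hc
  have hcpos : 0 < c := by positivity
  refine ⟨c / 8, by positivity, fun M hM t ht => ?_⟩
  have hM' : (0 : ℝ) < M := by positivity
  set x := meanLog M with hx
  have h : ∑ j ∈ Finset.Icc 1 M, (1 + t * (Real.log (j / M) - x)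
        + if Real.log 2 / 2 ≤ |Real.log (j / M) - x| then c else 0)
      ≤ ∑ j ∈ Finset.Icc 1 M, Real.exp (t * (Real.log (j / M) - x)) := by
    refine Finset.sum_le_sum fun j _ => ?_
    set y := Real.log (j / M) - x
    refine le_trans ?_ (add_min_le_exp (t * y))
    gcongr
    split_ifs with hy
    · refine min_le_min_right _ ?_
      gcongr ?_ / 4
      rw [← sq_abs (t * y), abs_mul]
      gcongr
    · positivity
  rw [Finset.sum_add_distrib, Finset.sum_add_distrib, ← Finset.mul_sum, hx,
    sum_log_sub_meanLog (by omega), ← hx, ← Finset.sum_filter, Finset.sum_const] at h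
  have hcard := mul_le_mul_of_nonneg_right (card_far_log hM x) hcpos.le
  rw [expMoment, ← div_eq_inv_mul, le_div_iff₀ hM']
  simp at h
  linarith

/-! ### Power means and the associated correlation matrix -/

/-- The mean of `(j / M) ^ t` over `1 ≤ j ≤ M`. -/
noncomputable def powMean (M : ℕ) (t : ℝ) : ℝ :=
  (M : ℝ)⁻¹ * ∑ j ∈ Finset.Icc 1 M, ((j : ℝ) / M) ^ t

theorem powMean_zero {M : ℕ} (hM : 1 ≤ M) : powMean M 0 = 1 := by
  have : (M : ℝ) ≠ 0 := by positivity
  simp [powMean, this]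

theorem half_le_powMean {M : ℕ} (hM : 1 ≤ M) {t : ℝ} (ht : t ≤ 1) : 1 / 2 ≤ powMean M t := by
  have hM' : (0 : ℝ) < M := by positivity
  have hsum : ∑ j ∈ Finset.Icc 1 M, (j : ℝ) = M * (M + 1) / 2 := by
    clear hM hM' ht
    induction M with
    | zero => simp
    | succ k ih => rw [Finset.sum_Icc_succ_top (by omega), ih]; push_cast; ring
  -- The terms decrease in the exponent, and the mean at exponent `1` is `(M + 1) / (2 M)`.
  have h : ∑ j ∈ Finset.Icc 1 M, (j : ℝ) / M ≤ ∑ j ∈ Finset.Icc 1 M, ((j : ℝ) / M) ^ t := by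
    refine Finset.sum_le_sum fun j hj => ?_
    rw [Finset.mem_Icc] at hj
    have hj0 : (0 : ℝ) < j := by exact_mod_cast hj.1
    have hj1 : (j : ℝ) / M ≤ 1 := by rw [div_le_one hM']; exact_mod_cast hj.2
    simpa using Real.rpow_le_rpow_of_exponent_ge (by positivity) hj1 ht
  rw [← Finset.sum_div, hsum] at h
  rw [powMean, ← div_eq_inv_mul, le_div_iff₀ hM']
  refine le_trans ?_ h
  rw [le_div_iff₀ hM']
  nlinarith

theorem expMoment_eq {M : ℕ} (t : ℝ) :
    expMoment M t = powMean M t * Real.exp (-(t * meanLog M)) := by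
  rw [expMoment, powMean, mul_assoc, Finset.sum_mul]
  congr 1
  refine Finset.sum_congr rfl fun j hj => ?_
  rw [Finset.mem_Icc] at hj
  have hj0 : (0 : ℝ) < j := by exact_mod_cast hj.1
  have hM0 : (0 : ℝ) < M := by exact_mod_cast (by omega : 0 < M)
  rw [Real.rpow_def_of_pos (by positivity), ← Real.exp_add]
  congr 1
  ring

/-- The correlation matrix of the functions `j ↦ (j / M) ^ θ r` under the uniform distribution on
`1, …, M` (second moments, not centred). -/
noncomputable def powCorr {q : ℕ} (M : ℕ) (θ : Fin q → ℝ) : Matrix (Fin q) (Fin q) ℝ :=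
  Matrix.of fun r s => powMean M (θ r + θ s) / (√(powMean M (2 * θ r)) * √(powMean M (2 * θ s)))

theorem powMean_add_le_sqrt_mul_sqrt (M : ℕ) (a b : ℝ) :
    powMean M (a + b) ≤ √(powMean M (2 * a)) * √(powMean M (2 * b)) := by
  rcases Nat.eq_zero_or_pos M with rfl | hM
  · simp [powMean]
  have hM' : (0 : ℝ) < M := by positivity
  have hpos : ∀ j ∈ Finset.Icc 1 M, (0 : ℝ) < (j : ℝ) / M := fun j hj => by
    rw [Finset.mem_Icc] at hj
    have hj0 : (0 : ℝ) < j := by exact_mod_cast hj.1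
    positivity
  have h := Real.sum_mul_le_sqrt_mul_sqrt (Finset.Icc 1 M)
    (fun j : ℕ => ((j : ℝ) / M) ^ a) (fun j : ℕ => ((j : ℝ) / M) ^ b)
  have e1 : ∀ c : ℝ, ∑ j ∈ Finset.Icc 1 M, (((j : ℝ) / M) ^ c) ^ 2 = M * powMean M (2 * c) := by
    intro c
    rw [powMean, mul_inv_cancel_left₀ hM'.ne']
    refine Finset.sum_congr rfl fun j hj => ?_
    rw [two_mul, Real.rpow_add (hpos j hj), sq]
  have e2 : ∑ j ∈ Finset.Icc 1 M, ((j : ℝ) / M) ^ a * ((j : ℝ) / M) ^ b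
      = M * powMean M (a + b) := by
    rw [powMean, mul_inv_cancel_left₀ hM'.ne']
    exact Finset.sum_congr rfl fun j hj => (Real.rpow_add (hpos j hj) a b).symm
  rw [e1, e1, e2, Real.sqrt_mul hM'.le, Real.sqrt_mul hM'.le] at h
  have h5 : √(M : ℝ) * √(M : ℝ) = M := Real.mul_self_sqrt hM'.le
  refine le_of_mul_le_mul_left (h.trans_eq ?_) hM'
  linear_combination (√(powMean M (2 * a)) * √(powMean M (2 * b))) * h5

theorem posSemidef_powCorr {q : ℕ} (M : ℕ) (θ : Fin q → ℝ) : (powCorr M θ).PosSemidef := by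
  have h : powCorr M θ = (M : ℝ)⁻¹ • ∑ j ∈ Finset.Icc 1 M,
      Matrix.vecMulVec (fun r => ((j : ℝ) / M) ^ θ r / √(powMean M (2 * θ r)))
        (star fun r => ((j : ℝ) / M) ^ θ r / √(powMean M (2 * θ r))) := by
    ext r s
    rw [Matrix.smul_apply, Matrix.sum_apply, smul_eq_mul, powCorr, Matrix.of_apply, powMean,
      mul_div_assoc, Finset.sum_div]
    congr 1
    refine Finset.sum_congr rfl fun j hj => ?_
    rw [Finset.mem_Icc] at hj
    have hj0 : (0 : ℝ) < j := by exact_mod_cast hj.1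
    have hM0 : (0 : ℝ) < M := by exact_mod_cast (by omega : 0 < M)
    rw [Real.rpow_add (by positivity), Matrix.vecMulVec_apply]
    simp only [star_trivial]
    rw [div_mul_div_comm]
  rw [h]
  exact (Matrix.posSemidef_sum _ fun j _ => Matrix.posSemidef_vecMulVec_self_star _).smul
    (by positivity)

theorem powCorr_diag {q : ℕ} {M : ℕ} (hM : 1 ≤ M) {θ : Fin q → ℝ} {r : Fin q}
    (hθ : 2 * θ r ≤ 1) : powCorr M θ r r = 1 := by
  have h := half_le_powMean hM hθ
  rw [powCorr, Matrix.of_apply, Real.mul_self_sqrt (by linarith), two_mul, div_self]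
  rw [← two_mul]; linarith

theorem powMean_nonneg (M : ℕ) (t : ℝ) : 0 ≤ powMean M t := by
  rw [powMean]
  exact mul_nonneg (by positivity) (Finset.sum_nonneg fun j _ => Real.rpow_nonneg (by positivity) _)

theorem abs_powCorr_le_one {q : ℕ} (M : ℕ) (θ : Fin q → ℝ) (r s : Fin q) :
    |powCorr M θ r s| ≤ 1 := by
  rw [powCorr, Matrix.of_apply,
    abs_of_nonneg (div_nonneg (powMean_nonneg _ _) (by positivity))]
  exact div_le_one_of_le₀ (powMean_add_le_sqrt_mul_sqrt M _ _) (by positivity)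

/-! ### The limiting matrix -/

/-- The real part of `diag(e^{iπ d_r/2}) G diag(e^{-iπ d_s/2})`. -/
noncomputable def phaseMatrix {q : ℕ} (G : Matrix (Fin q) (Fin q) ℝ) (d : Fin q → ℝ) :
    Matrix (Fin q) (Fin q) ℝ :=
  Matrix.of fun r s => Real.cos (Real.pi * (d r - d s) / 2) * G r s

theorem posDef_phaseMatrix {q : ℕ} {G : Matrix (Fin q) (Fin q) ℝ} (hG : G.PosDef)
    (d : Fin q → ℝ) : (phaseMatrix G d).PosDef := by
  refine Matrix.PosDef.of_dotProduct_mulVec_pos ?_ fun x hx => ?_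
  · ext r s
    have hs : G s r = G r s := by simpa using hG.isHermitian.apply r s
    simp only [Matrix.conjTranspose_apply, phaseMatrix, Matrix.of_apply, star_trivial, hs]
    rw [← Real.cos_neg]
    congr 2
    ring
  -- With `a = π d / 2`, the form at `x` is the sum of the forms of `G` at `x cos a`, `x sin a`.
  set u : Fin q → ℝ := fun r => x r * Real.cos (Real.pi * d r / 2) with hu
  set v : Fin q → ℝ := fun r => x r * Real.sin (Real.pi * d r / 2) with hv
  have hsplit : star x ⬝ᵥ (phaseMatrix G d).mulVec x
      = star u ⬝ᵥ G.mulVec u + star v ⬝ᵥ G.mulVec v := by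
    simp only [star_trivial, dotProduct, Matrix.mulVec, Finset.mul_sum, ← Finset.sum_add_distrib]
    refine Finset.sum_congr rfl fun r _ => Finset.sum_congr rfl fun s _ => ?_
    simp only [phaseMatrix, Matrix.of_apply, hu, hv]
    rw [show Real.pi * (d r - d s) / 2 = Real.pi * d r / 2 - Real.pi * d s / 2 by ring,
      Real.cos_sub]
    ring
  rw [hsplit]
  have hu0 := hG.posSemidef.dotProduct_mulVec_nonneg u
  have hv0 := hG.posSemidef.dotProduct_mulVec_nonneg v
  obtain ⟨r, hr⟩ := Function.ne_iff.1 hx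
  by_cases hc : u = 0
  · have hvr : v ≠ 0 := by
      intro hv'
      have h1 : u r = 0 := congrFun hc r
      have h2 : v r = 0 := congrFun hv' r
      simp only [hu, hv, mul_eq_zero] at h1 h2
      have h1' := h1.resolve_left hr
      have h2' := h2.resolve_left hr
      have := Real.sin_sq_add_cos_sq (Real.pi * d r / 2)
      rw [h1', h2'] at this
      norm_num at this
    linarith [hG.dotProduct_mulVec_pos hvr]
  · linarith [hG.dotProduct_mulVec_pos hc]

/-! ### The normalised matrix `Ĝ` -/

theorem fourierFreq_pos {n j : ℕ} (hn : 1 ≤ n) (hj : 1 ≤ j) : 0 < fourierFreq n j := by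
  have h1 : (0 : ℝ) < j := by exact_mod_cast hj
  have h2 : (0 : ℝ) < n := by exact_mod_cast hn
  have := Real.pi_pos
  rw [fourierFreq]; positivity

theorem fourierFreq_eq_mul {n M : ℕ} (hM : 1 ≤ M) (j : ℕ) :
    fourierFreq n j = fourierFreq n M * ((j : ℝ) / M) := by
  have h1 : (M : ℝ) ≠ 0 := by positivity
  rw [fourierFreq, fourierFreq]; field_simp

theorem Ghat_apply {q : ℕ} (n m : ℕ) (F : ℝ → Matrix (Fin q) (Fin q) ℂ) (d : Fin q → ℝ)
    (r s : Fin q) : Ghat n m F d r s = (m : ℝ)⁻¹ * ∑ j ∈ Finset.Icc 1 m,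
      fourierFreq n j ^ d r * fourierFreq n j ^ d s * (F (fourierFreq n j) r s).re := by
  rw [Ghat, Matrix.smul_apply, Matrix.sum_apply, smul_eq_mul]
  congr 1
  refine Finset.sum_congr rfl fun j _ => ?_
  rw [Matrix.map_apply, Matrix.mul_diagonal, Matrix.diagonal_mul, mul_right_comm,
    ← Complex.ofReal_mul, Complex.re_ofReal_mul]

/-- The factor by which row and column `r` of `Ĝ(d)` are divided to normalise it: the power
`d r - d₀ r` of the largest frequency, times the root mean square of `(j / m) ^ (d r - d₀ r)`. -/
noncomputable def scaleFactor {q : ℕ} (n m : ℕ) (d₀ d : Fin q → ℝ) (r : Fin q) : ℝ :=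
  fourierFreq n m ^ (d r - d₀ r) * √(powMean m (2 * (d r - d₀ r)))

/-- `Ĝ(d)` with its rows and columns divided by `scaleFactor`. -/
noncomputable def normGhat {q : ℕ} (n m : ℕ) (F : ℝ → Matrix (Fin q) (Fin q) ℂ)
    (d₀ d : Fin q → ℝ) : Matrix (Fin q) (Fin q) ℝ :=
  Matrix.of fun r s => Ghat n m F d r s / (scaleFactor n m d₀ d r * scaleFactor n m d₀ d s)

/-- The approximation of the spectral density that the argument uses: on the frequencies
`λ_j`, `1 ≤ j ≤ m`, the real part of `F` is within `κ λ_j^{-d_r-d_s} + κ n^{-β}` of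
`P_{rs} λ_j^{-d_r-d_s}`. -/
def IsCloseSpectrum {q : ℕ} (n m : ℕ) (β κ : ℝ) (P : Matrix (Fin q) (Fin q) ℝ) (d₀ : Fin q → ℝ)
    (F : ℝ → Matrix (Fin q) (Fin q) ℂ) : Prop :=
  ∀ j ∈ Finset.Icc 1 m, ∀ r s, |(F (fourierFreq n j) r s).re
    - P r s * fourierFreq n j ^ (-d₀ r - d₀ s)|
    ≤ κ * fourierFreq n j ^ (-d₀ r - d₀ s) + κ * (n : ℝ) ^ (-β)

section Normalised

variable {q n m : ℕ} {β κ : ℝ} {P : Matrix (Fin q) (Fin q) ℝ} {d₀ d : Fin q → ℝ}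
  {F : ℝ → Matrix (Fin q) (Fin q) ℂ}

theorem two_mul_sub_le_one (hβ : β ≤ 1) (hd₀ : ∀ r, d₀ r ∈ Set.Icc (-β / 2) 0)
    (hd : ∀ r, d r ∈ Set.Icc (-β / 2) 0) (r : Fin q) : 2 * (d r - d₀ r) ≤ 1 := by
  linarith [(hd r).2, (hd₀ r).1]

theorem scaleFactor_pos (hn : 1 ≤ n) (hm : 1 ≤ m) {r : Fin q} (h : 2 * (d r - d₀ r) ≤ 1) :
    0 < scaleFactor n m d₀ d r := by
  have h1 := half_le_powMean hm h
  exact mul_pos (Real.rpow_pos_of_pos (fourierFreq_pos hn hm) _)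
    (Real.sqrt_pos.2 (by linarith))

theorem det_Ghat (hn : 1 ≤ n) (hm : 1 ≤ m) (h : ∀ r, 2 * (d r - d₀ r) ≤ 1) :
    (Ghat n m F d).det = (∏ r, scaleFactor n m d₀ d r) ^ 2 * (normGhat n m F d₀ d).det := by
  have e : Ghat n m F d = Matrix.diagonal (scaleFactor n m d₀ d) * normGhat n m F d₀ d
      * Matrix.diagonal (scaleFactor n m d₀ d) := by
    ext r s
    rw [Matrix.mul_diagonal, Matrix.diagonal_mul, normGhat, Matrix.of_apply]
    have h1 := (scaleFactor_pos (n := n) hn hm (h r)).ne'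
    have h2 := (scaleFactor_pos (n := n) hn hm (h s)).ne'
    field_simp
  rw [e, Matrix.det_mul, Matrix.det_mul, Matrix.det_diagonal]
  ring

/-- The weight that the estimation error at frequency `λ_j` receives, after division by the power
of the largest frequency, is at most `n^β`, throughout the parameter box. -/
theorem weight_le (hn : 1 ≤ n) (hm : 1 ≤ m) (hle : fourierFreq n m ≤ 1) (hβ : 0 ≤ β)
    (hd₀ : ∀ r, d₀ r ∈ Set.Icc (-β / 2) 0) (hd : ∀ r, d r ∈ Set.Icc (-β / 2) 0) (r s : Fin q)
    {j : ℕ} (hj : j ∈ Finset.Icc 1 m) :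
    ((j : ℝ) / m) ^ ((d r - d₀ r) + (d s - d₀ s)) * fourierFreq n j ^ (d₀ r + d₀ s)
      ≤ (n : ℝ) ^ β := by
  rw [Finset.mem_Icc] at hj
  have hj0 : (0 : ℝ) < j := by exact_mod_cast hj.1
  have hm0 : (0 : ℝ) < m := by exact_mod_cast hm
  have hn0 : (0 : ℝ) < n := by exact_mod_cast hn
  have hu : (0 : ℝ) < (j : ℝ) / m := by positivity
  have hu1 : (j : ℝ) / m ≤ 1 := by rw [div_le_one hm0]; exact_mod_cast hj.2
  have hl := fourierFreq_pos hn hm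
  have h1 : ((j : ℝ) / m) ^ ((d r - d₀ r) + (d s - d₀ s)) * fourierFreq n j ^ (d₀ r + d₀ s)
      = ((j : ℝ) / m) ^ (d r + d s) * fourierFreq n m ^ (d₀ r + d₀ s) := by
    rw [fourierFreq_eq_mul hm j, Real.mul_rpow hl.le hu.le, mul_left_comm, ← Real.rpow_add hu,
      mul_comm]
    congr 2
    ring
  have h2 : ((j : ℝ) / m) ^ (d r + d s) ≤ ((j : ℝ) / m) ^ (-β) :=
    Real.rpow_le_rpow_of_exponent_ge hu hu1 (by linarith [(hd r).1, (hd s).1])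
  have h3 : fourierFreq n m ^ (d₀ r + d₀ s) ≤ fourierFreq n m ^ (-β) :=
    Real.rpow_le_rpow_of_exponent_ge hl hle (by linarith [(hd₀ r).1, (hd₀ s).1])
  have h4 : (n : ℝ)⁻¹ ≤ fourierFreq n m * ((j : ℝ) / m) := by
    rw [← fourierFreq_eq_mul hm j, fourierFreq, inv_eq_one_div]
    gcongr
    have : (1 : ℝ) ≤ j := by exact_mod_cast hj.1
    nlinarith [Real.pi_gt_three]
  calc _ = _ := h1
    _ ≤ ((j : ℝ) / m) ^ (-β) * fourierFreq n m ^ (-β) := by gcongr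
    _ = (fourierFreq n m * ((j : ℝ) / m)) ^ (-β) := by
      rw [Real.mul_rpow hl.le hu.le, mul_comm]
    _ ≤ ((n : ℝ)⁻¹) ^ (-β) :=
      Real.rpow_le_rpow_of_nonpos (by positivity) h4 (by linarith)
    _ = (n : ℝ) ^ β := by rw [Real.inv_rpow hn0.le, Real.rpow_neg hn0.le, inv_inv]

theorem abs_Ghat_sub_le (hn : 1 ≤ n) (hm : 1 ≤ m) (hle : fourierFreq n m ≤ 1) (hβ : 0 ≤ β)
    (hκ : 0 ≤ κ) (hd₀ : ∀ r, d₀ r ∈ Set.Icc (-β / 2) 0) (hd : ∀ r, d r ∈ Set.Icc (-β / 2) 0)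
    (hF : IsCloseSpectrum n m β κ P d₀ F) (r s : Fin q) :
    |Ghat n m F d r s / (fourierFreq n m ^ (d r - d₀ r) * fourierFreq n m ^ (d s - d₀ s))
      - powMean m ((d r - d₀ r) + (d s - d₀ s)) * P r s|
      ≤ κ * powMean m ((d r - d₀ r) + (d s - d₀ s)) + κ := by
  have hm0 : (0 : ℝ) < m := by exact_mod_cast hm
  have hn0 : (0 : ℝ) < n := by exact_mod_cast hn
  have hl := fourierFreq_pos hn hm
  set τ := (d r - d₀ r) + (d s - d₀ s) with hτ
  have hterm : ∀ j ∈ Finset.Icc 1 m, fourierFreq n j ^ d r * fourierFreq n j ^ d s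
      / (fourierFreq n m ^ (d r - d₀ r) * fourierFreq n m ^ (d s - d₀ s))
      = ((j : ℝ) / m) ^ τ * fourierFreq n j ^ (d₀ r + d₀ s) := by
    intro j hj
    rw [Finset.mem_Icc] at hj
    have hj0 : (0 : ℝ) < j := by exact_mod_cast hj.1
    have hu : (0 : ℝ) < (j : ℝ) / m := by positivity
    have hlj := fourierFreq_pos hn hj.1
    rw [div_eq_iff (by positivity), ← Real.rpow_add hl, ← Real.rpow_add hlj, ← hτ,
      mul_right_comm, ← Real.mul_rpow hu.le hl.le, mul_comm ((j : ℝ) / m),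
      ← fourierFreq_eq_mul hm j, ← Real.rpow_add hlj]
    congr 1
    rw [hτ]; ring
  have hrewrite : Ghat n m F d r s
      / (fourierFreq n m ^ (d r - d₀ r) * fourierFreq n m ^ (d s - d₀ s)) - powMean m τ * P r s
      = (m : ℝ)⁻¹ * ∑ j ∈ Finset.Icc 1 m, ((j : ℝ) / m) ^ τ * fourierFreq n j ^ (d₀ r + d₀ s)
        * ((F (fourierFreq n j) r s).re - P r s * fourierFreq n j ^ (-d₀ r - d₀ s)) := by
    rw [Ghat_apply, powMean, mul_div_assoc, mul_assoc, ← mul_sub, Finset.sum_div, Finset.sum_mul,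
      ← Finset.sum_sub_distrib]
    congr 1
    refine Finset.sum_congr rfl fun j hj => ?_
    have hlj := fourierFreq_pos hn (Finset.mem_Icc.1 hj).1
    rw [mul_div_right_comm, hterm j hj, mul_sub]
    congr 1
    have hone : fourierFreq n j ^ (d₀ r + d₀ s) * fourierFreq n j ^ (-d₀ r - d₀ s) = 1 := by
      rw [← Real.rpow_add hlj, show d₀ r + d₀ s + (-d₀ r - d₀ s) = 0 by ring, Real.rpow_zero]
    linear_combination -(((j : ℝ) / m) ^ τ * P r s) * hone
  have hbound : ∀ j ∈ Finset.Icc 1 m, |((j : ℝ) / m) ^ τ * fourierFreq n j ^ (d₀ r + d₀ s)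
      * ((F (fourierFreq n j) r s).re - P r s * fourierFreq n j ^ (-d₀ r - d₀ s))|
      ≤ κ * ((j : ℝ) / m) ^ τ + κ := by
    intro j hj
    have hj' := hj
    rw [Finset.mem_Icc] at hj'
    have hj0 : (0 : ℝ) < j := by exact_mod_cast hj'.1
    have hlj := fourierFreq_pos hn hj'.1
    have hw0 : 0 ≤ ((j : ℝ) / m) ^ τ * fourierFreq n j ^ (d₀ r + d₀ s) := by positivity
    have hw := weight_le hn hm hle hβ hd₀ hd r s hj
    rw [← hτ] at hw
    have hone : fourierFreq n j ^ (d₀ r + d₀ s) * fourierFreq n j ^ (-d₀ r - d₀ s) = 1 := by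
      rw [← Real.rpow_add hlj, show d₀ r + d₀ s + (-d₀ r - d₀ s) = 0 by ring, Real.rpow_zero]
    have hnn : (n : ℝ) ^ β * (n : ℝ) ^ (-β) = 1 := by
      rw [← Real.rpow_add hn0, add_neg_cancel, Real.rpow_zero]
    rw [abs_mul, abs_of_nonneg hw0]
    refine (mul_le_mul_of_nonneg_left (hF j hj r s) hw0).trans ?_
    have h1 : ((j : ℝ) / m) ^ τ * fourierFreq n j ^ (d₀ r + d₀ s) * (κ * (n : ℝ) ^ (-β))
        ≤ (n : ℝ) ^ β * (κ * (n : ℝ) ^ (-β)) := by gcongr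
    have h2 : (n : ℝ) ^ β * (κ * (n : ℝ) ^ (-β)) = κ := by linear_combination κ * hnn
    have h3 : ((j : ℝ) / m) ^ τ * fourierFreq n j ^ (d₀ r + d₀ s)
        * (κ * fourierFreq n j ^ (-d₀ r - d₀ s)) = κ * ((j : ℝ) / m) ^ τ := by
      linear_combination κ * ((j : ℝ) / m) ^ τ * hone
    rw [mul_add]
    linarith
  rw [hrewrite, abs_mul, abs_of_pos (inv_pos.2 hm0)]
  refine (mul_le_mul_of_nonneg_left ((Finset.abs_sum_le_sum_abs _ _).trans
    (Finset.sum_le_sum hbound)) (inv_pos.2 hm0).le).trans_eq ?_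
  rw [Finset.sum_add_distrib, ← Finset.mul_sum, powMean]
  simp
  field_simp

theorem abs_normGhat_sub_le (hn : 1 ≤ n) (hm : 1 ≤ m) (hle : fourierFreq n m ≤ 1)
    (hβ : β ∈ Set.Icc (0 : ℝ) 1) (hκ : 0 ≤ κ) (hd₀ : ∀ r, d₀ r ∈ Set.Icc (-β / 2) 0)
    (hd : ∀ r, d r ∈ Set.Icc (-β / 2) 0) (hF : IsCloseSpectrum n m β κ P d₀ F) (r s : Fin q) :
    |normGhat n m F d₀ d r s - (powCorr m (d - d₀)).hadamard P r s| ≤ 3 * κ := by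
  have key := abs_Ghat_sub_le hn hm hle hβ.1 hκ hd₀ hd hF r s
  have hr := half_le_powMean hm (two_mul_sub_le_one hβ.2 hd₀ hd r)
  have hs := half_le_powMean hm (two_mul_sub_le_one hβ.2 hd₀ hd s)
  set a := powMean m (2 * (d r - d₀ r)) with ha
  set b := powMean m (2 * (d s - d₀ s)) with hb
  have hc := powMean_add_le_sqrt_mul_sqrt m (d r - d₀ r) (d s - d₀ s)
  set c := powMean m ((d r - d₀ r) + (d s - d₀ s)) with hc'
  rw [← ha, ← hb] at hc
  have hlr := Real.rpow_pos_of_pos (fourierFreq_pos (n := n) hn hm) (d r - d₀ r)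
  have hls := Real.rpow_pos_of_pos (fourierFreq_pos (n := n) hn hm) (d s - d₀ s)
  have hab : 1 / 2 ≤ √a * √b := by
    rw [← Real.sqrt_mul (by linarith)]
    exact Real.le_sqrt_of_sq_le (by nlinarith)
  have hsa : 0 < √a := Real.sqrt_pos.2 (by linarith)
  have hsb : 0 < √b := Real.sqrt_pos.2 (by linarith)
  have e : normGhat n m F d₀ d r s - (powCorr m (d - d₀)).hadamard P r s
      = (Ghat n m F d r s / (fourierFreq n m ^ (d r - d₀ r) * fourierFreq n m ^ (d s - d₀ s))
        - c * P r s) / (√a * √b) := by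
    simp only [normGhat, powCorr, scaleFactor, Matrix.of_apply, Matrix.hadamard_apply,
      Pi.sub_apply, ← ha, ← hb, ← hc']
    field_simp
  rw [e, abs_div, abs_of_pos (mul_pos hsa hsb), div_le_iff₀ (mul_pos hsa hsb)]
  refine key.trans ?_
  nlinarith

end Normalised

/-! ### The objective function away from the true parameter -/

section Objective

variable {q n m : ℕ} {d₀ d : Fin q → ℝ} {F : ℝ → Matrix (Fin q) (Fin q) ℂ}

theorem mean_log_fourierFreq (hn : 1 ≤ n) (hm : 1 ≤ m) :
    (m : ℝ)⁻¹ * ∑ j ∈ Finset.Icc 1 m, Real.log (fourierFreq n j)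
      = Real.log (fourierFreq n m) + meanLog m := by
  have hm0 : (0 : ℝ) < m := by exact_mod_cast hm
  have : ∀ j ∈ Finset.Icc 1 m, Real.log (fourierFreq n j)
      = Real.log (fourierFreq n m) + Real.log (j / m) := fun j hj => by
    have hj0 : (0 : ℝ) < j := by exact_mod_cast (Finset.mem_Icc.1 hj).1
    rw [fourierFreq_eq_mul hm j, Real.log_mul (fourierFreq_pos hn hm).ne' (by positivity)]
  rw [Finset.sum_congr rfl this, Finset.sum_add_distrib, meanLog]
  simp
  field_simp

/-- The objective function splits into a part that does not depend on `d`, the logarithms of the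
exponential moments at `2 (d - d₀)`, and the log-determinant of the normalised matrix. -/
theorem objective_eq (hn : 1 ≤ n) (hm : 1 ≤ m) (h : ∀ r, 2 * (d r - d₀ r) ≤ 1)
    (hdet : 0 < (normGhat n m F d₀ d).det) :
    objective n m F d = -2 * ∑ k, d₀ k * (Real.log (fourierFreq n m) + meanLog m)
      + ∑ k, Real.log (expMoment m (2 * (d k - d₀ k)))
      + Real.log (normGhat n m F d₀ d).det := by
  have hl := fourierFreq_pos hn hm
  have hs : ∀ r, 0 < scaleFactor n m d₀ d r := fun r => scaleFactor_pos hn hm (h r)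
  have hprod : 0 < ∏ r, scaleFactor n m d₀ d r := Finset.prod_pos fun r _ => hs r
  rw [objective, det_Ghat hn hm h, Real.log_mul (by positivity) hdet.ne', Real.log_pow,
    Real.log_prod (fun r _ => (hs r).ne'), mean_log_fourierFreq hn hm]
  have hk : ∀ k, 2 * Real.log (scaleFactor n m d₀ d k)
      - 2 * (d k * (Real.log (fourierFreq n m) + meanLog m))
      = -2 * (d₀ k * (Real.log (fourierFreq n m) + meanLog m))
        + Real.log (expMoment m (2 * (d k - d₀ k))) := fun k => by
    have hp : 0 < powMean m (2 * (d k - d₀ k)) := by linarith [half_le_powMean hm (h k)]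
    rw [scaleFactor, Real.log_mul (by positivity) (by positivity), Real.log_rpow hl,
      Real.log_sqrt hp.le, expMoment_eq, Real.log_mul hp.ne' (Real.exp_pos _).ne', Real.log_exp]
    ring
  have hsum := Finset.sum_congr (rfl : (Finset.univ : Finset (Fin q)) = _) fun k _ => hk k
  simp only [Finset.sum_sub_distrib, Finset.sum_add_distrib, ← Finset.mul_sum] at hsum
  push_cast
  linarith

theorem continuous_Ghat (hn : 1 ≤ n) : Continuous fun d => Ghat n m F d := by
  refine continuous_matrix fun r s => ?_
  simp only [Ghat_apply]
  refine continuous_const.mul (continuous_finsetSum _ fun j hj => ?_)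
  have hne := (fourierFreq_pos hn (Finset.mem_Icc.1 hj).1).ne'
  exact (((Real.continuous_const_rpow hne).comp (continuous_apply r)).mul
    ((Real.continuous_const_rpow hne).comp (continuous_apply s))).mul continuous_const

end Objective

/-- Separation of the true parameter: if the spectrum is close enough to its power law on the
frequencies in use, then on the whole parameter box `Ĝ` has positive determinant, and away
from `d₀` the objective function exceeds its value at `d₀`. -/
theorem exists_objective_separated {q : ℕ} {β : ℝ} (hβ : β ∈ Set.Icc (0 : ℝ) 1)
    {P : Matrix (Fin q) (Fin q) ℝ} (hP : P.PosDef) {d₀ : Fin q → ℝ}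
    (hd₀ : ∀ r, d₀ r ∈ Set.Icc (-β / 2) 0) {η : ℝ} (hη : 0 < η) :
    ∃ κ > 0, ∀ (n m : ℕ) (F : ℝ → Matrix (Fin q) (Fin q) ℂ), 1 ≤ n → 8 ≤ m →
      fourierFreq n m ≤ 1 → IsCloseSpectrum n m β κ P d₀ F →
      ∀ d : Fin q → ℝ, (∀ r, d r ∈ Set.Icc (-β / 2) 0) → 0 < (Ghat n m F d).det ∧
        (η ≤ dist d d₀ → objective n m F d₀ < objective n m F d) := by
  obtain ⟨ρ, hρ, hgap⟩ := exists_gap_expMoment hη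
  set D := P.det with hD
  have hDpos : 0 < D := hP.det_pos
  -- This choice gives `D + ε < (1 + ρ) * (D - ε)`.
  set ε := ρ * D / (2 * (2 + ρ)) with hε
  have hεpos : 0 < ε := by positivity
  have hε1 : ε * (2 * (2 + ρ)) = ρ * D := by rw [hε]; field_simp
  have hεD : ε < D := by nlinarith
  obtain ⟨κ, hκ, hcont⟩ := exists_abs_det_sub_lt q (∑ r, ∑ s, |P r s|) hεpos
  refine ⟨κ / 3, by positivity, fun n m F hn hm hle hF => ?_⟩
  have hm1 : 1 ≤ m := by omega
  have hclose : ∀ d : Fin q → ℝ, (∀ r, d r ∈ Set.Icc (-β / 2) 0) →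
      |(normGhat n m F d₀ d).det - ((powCorr m (d - d₀)).hadamard P).det| < ε := by
    intro d hd
    have h := hcont ((powCorr m (d - d₀)).hadamard P)
      (normGhat n m F d₀ d - (powCorr m (d - d₀)).hadamard P) (fun r s => ?_) fun r s => ?_
    · rwa [add_sub_cancel] at h
    · rw [Matrix.hadamard_apply, abs_mul]
      calc _ ≤ 1 * |P r s| := by gcongr; exact abs_powCorr_le_one _ _ _ _
        _ = |P r s| := one_mul _
        _ ≤ ∑ s, |P r s| :=
          Finset.single_le_sum (f := fun s => |P r s|) (fun _ _ => abs_nonneg _)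
            (Finset.mem_univ s)
        _ ≤ _ := Finset.single_le_sum (f := fun r => ∑ s, |P r s|)
            (fun _ _ => Finset.sum_nonneg fun _ _ => abs_nonneg _) (Finset.mem_univ r)
    · have := abs_normGhat_sub_le hn hm1 hle hβ (by positivity) hd₀ hd hF r s
      rw [Matrix.sub_apply]
      linarith
  have hlower : ∀ d : Fin q → ℝ, (∀ r, d r ∈ Set.Icc (-β / 2) 0) →
      D - ε < (normGhat n m F d₀ d).det := by
    intro d hd
    have h1 := det_hadamard_ge hP (posSemidef_powCorr m (d - d₀))
    have h2 : ∏ r, powCorr m (d - d₀) r r = 1 := Finset.prod_eq_one fun r _ =>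
      powCorr_diag hm1 (two_mul_sub_le_one hβ.2 hd₀ hd r)
    rw [h2, mul_one, Matrix.hadamard_comm] at h1
    linarith [(abs_lt.1 (hclose d hd)).1]
  have hupper : (normGhat n m F d₀ d₀).det < D + ε := by
    have h1 : (powCorr m (d₀ - d₀)).hadamard P = P := by
      ext r s
      simp [powCorr, powMean_zero hm1]
    have h2 := hclose d₀ hd₀
    rw [h1] at h2
    linarith [(abs_lt.1 h2).2]
  intro d hd
  have hdet := hlower d hd
  refine ⟨?_, fun hdist => ?_⟩
  · rw [det_Ghat hn hm1 (two_mul_sub_le_one hβ.2 hd₀ hd)]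
    have : 0 < ∏ r, scaleFactor n m d₀ d r := Finset.prod_pos fun r _ =>
      scaleFactor_pos hn hm1 (two_mul_sub_le_one hβ.2 hd₀ hd r)
    have : 0 < (normGhat n m F d₀ d).det := by linarith
    positivity
  have hdet₀ := hlower d₀ hd₀
  rw [objective_eq hn hm1 (two_mul_sub_le_one hβ.2 hd₀ hd) (by linarith),
    objective_eq hn hm1 (two_mul_sub_le_one hβ.2 hd₀ hd₀) (by linarith)]
  have hzero : ∑ k, Real.log (expMoment m (2 * (d₀ k - d₀ k))) = 0 := by
    refine Finset.sum_eq_zero fun k _ => ?_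
    simp [expMoment_eq, powMean_zero hm1]
  have hnn : ∀ k ∈ Finset.univ, 0 ≤ Real.log (expMoment m (2 * (d k - d₀ k))) :=
    fun k _ => Real.log_nonneg (one_le_expMoment hm1 _)
  obtain ⟨k, hk⟩ : ∃ k, η ≤ |d k - d₀ k| := by
    by_contra! hcon
    exact hdist.not_gt ((dist_pi_lt_iff hη).2 fun k => by rw [Real.dist_eq]; exact hcon k)
  have hbig : Real.log (1 + ρ) ≤ ∑ k, Real.log (expMoment m (2 * (d k - d₀ k))) := by
    refine le_trans (Real.log_le_log (by positivity) (hgap m hm _ ?_))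
      (Finset.single_le_sum hnn (Finset.mem_univ k))
    rw [abs_mul, abs_two]
    linarith
  have hlog : Real.log (normGhat n m F d₀ d₀).det
      < Real.log (1 + ρ) + Real.log (normGhat n m F d₀ d).det := by
    rw [← Real.log_mul (by positivity) (by linarith)]
    refine Real.log_lt_log (by linarith) ?_
    nlinarith
  linarith

/-! ### Consistency -/

/-- The power law `AssumptionA1` and uniform closeness of the estimate to `f` give closeness of its real part to
the power law, as soon as the frequencies in use are small. -/
theorem exists_isCloseSpectrum {q : ℕ} {f : ℝ → Matrix (Fin q) (Fin q) ℂ}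
    {G₀ : Matrix (Fin q) (Fin q) ℝ} {d₀ : Fin q → ℝ} (hA1 : AssumptionA1 f G₀ d₀) (β : ℝ)
    {κ : ℝ} (hκ : 0 < κ) :
    ∃ δ > 0, ∀ (n m : ℕ) (F : ℝ → Matrix (Fin q) (Fin q) ℂ), 1 ≤ n → fourierFreq n m < δ →
      (∀ j ∈ Finset.Icc 1 m,
        (n : ℝ) ^ β * supNorm (F (fourierFreq n j) - f (fourierFreq n j)) < κ) →
      IsCloseSpectrum n m β κ (phaseMatrix G₀ d₀) d₀ F := by
  have hev : ∀ᶠ x in 𝓝[>] (0 : ℝ), ∀ r s, ‖f x r s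
      - Complex.exp (Complex.I * (Real.pi * (d₀ r - d₀ s) / 2 : ℝ)) * (G₀ r s : ℂ)
        * ((x ^ (-d₀ r - d₀ s) : ℝ) : ℂ)‖ ≤ κ * ‖x ^ (-d₀ r - d₀ s)‖ :=
    eventually_all.2 fun r => eventually_all.2 fun s => (hA1 r s).def hκ
  obtain ⟨δ, hδ, h⟩ := mem_nhdsGT_iff_exists_Ioo_subset.1 hev
  refine ⟨δ, hδ, fun n m F hn hlt hF j hj r s => ?_⟩
  have hj' := Finset.mem_Icc.1 hj
  have hn0 : (0 : ℝ) < n := by exact_mod_cast hn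
  have hpos := fourierFreq_pos hn hj'.1
  have hjm : fourierFreq n j ≤ fourierFreq n m := by
    have : (j : ℝ) ≤ m := by exact_mod_cast hj'.2
    have := Real.pi_pos
    rw [fourierFreq, fourierFreq]
    gcongr
  have h1 := h (show fourierFreq n j ∈ Set.Ioo 0 δ from ⟨hpos, hjm.trans_lt hlt⟩) r s
  have h2 := hF j hj
  set x := fourierFreq n j
  have hxp : 0 < x ^ (-d₀ r - d₀ s) := Real.rpow_pos_of_pos hpos _
  have hre : |(f x r s).re - phaseMatrix G₀ d₀ r s * x ^ (-d₀ r - d₀ s)|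
      ≤ κ * x ^ (-d₀ r - d₀ s) := by
    rw [Real.norm_of_nonneg hxp.le] at h1
    refine le_trans (le_of_eq ?_) ((Complex.abs_re_le_norm _).trans h1)
    rw [Complex.sub_re, mul_assoc, ← Complex.ofReal_mul, Complex.re_mul_ofReal,
      mul_comm Complex.I, Complex.exp_ofReal_mul_I_re, phaseMatrix, Matrix.of_apply, mul_assoc]
  have hsup : |(F x r s).re - (f x r s).re| ≤ κ * (n : ℝ) ^ (-β) := by
    have h3 : ‖(F x - f x) r s‖ ≤ supNorm (F x - f x) :=
      (norm_le_pi_norm (fun s => (F x - f x) r s) s).trans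
        (norm_le_pi_norm (fun r s => (F x - f x) r s) r)
    have h4 : |(F x r s).re - (f x r s).re| ≤ ‖(F x - f x) r s‖ := by
      simpa using Complex.abs_re_le_norm ((F x - f x) r s)
    refine (h4.trans h3).trans ?_
    rw [Real.rpow_neg hn0.le, ← div_eq_mul_inv, le_div_iff₀ (by positivity), mul_comm]
    exact h2.le
  calc _ = |((F x r s).re - (f x r s).re)
        + ((f x r s).re - phaseMatrix G₀ d₀ r s * x ^ (-d₀ r - d₀ s))| := by congr 1; ring
    _ ≤ _ := abs_add_le _ _
    _ ≤ _ := by linarith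

/-- Where the objective function is separated from its value at `d₀` on the closed parameter box,
a minimiser over the parameter set exists, and every minimiser is near `d₀`. -/
theorem exists_isMinOn_and_dist_lt {q n m : ℕ} {β : ℝ} {B : Set (Fin q → ℝ)} (hB : IsClosed B)
    {d₀ : Fin q → ℝ} (hd₀ : d₀ ∈ paramSet β B) {F : ℝ → Matrix (Fin q) (Fin q) ℂ} (hn : 1 ≤ n)
    {η : ℝ} (hball : Metric.ball d₀ η ⊆ Set.univ.pi fun _ => Set.Ioi (-1 / 2))
    (hsep : ∀ d : Fin q → ℝ, (∀ r, d r ∈ Set.Icc (-β / 2) 0) → 0 < (Ghat n m F d).det ∧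
        (η ≤ dist d d₀ → objective n m F d₀ < objective n m F d)) :
    (∃ d ∈ paramSet β B, IsMinOn (objective n m F) (paramSet β B) d) ∧
      ∀ d ∈ paramSet β B, IsMinOn (objective n m F) (paramSet β B) d → dist d d₀ < η := by
  set box : Set (Fin q → ℝ) := Set.univ.pi fun _ => Set.Icc (-β / 2) 0 with hbox
  have hmem : ∀ d ∈ box, ∀ r, d r ∈ Set.Icc (-β / 2) 0 := fun d hd r => hd r (Set.mem_univ r)
  have hsub : paramSet β B ⊆ box ∩ B := fun d hd => ⟨hd.1.1, hd.2⟩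
  have hnear : ∀ d ∈ box, objective n m F d ≤ objective n m F d₀ → dist d d₀ < η :=
    fun d hd hle => by
      by_contra! hcon
      exact hle.not_gt ((hsep d (hmem d hd)).2 hcon)
  refine ⟨?_, fun d hd hmin => hnear d (hsub hd).1 (hmin hd₀)⟩
  have hcompact : IsCompact (box ∩ B) :=
    (isCompact_univ_pi fun _ => isCompact_Icc).inter_right hB
  have hcont : ContinuousOn (objective n m F) (box ∩ B) := by
    refine ContinuousOn.sub (ContinuousOn.log ?_ fun d hd => ?_) ?_
    · exact (continuous_Ghat hn).matrix_det.continuousOn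
    · exact (hsep d (hmem d hd.1)).1.ne'
    · exact Continuous.continuousOn (by fun_prop)
  obtain ⟨d, hd, hmin⟩ := hcompact.exists_isMinOn ⟨d₀, hsub hd₀⟩ hcont
  -- Proximity to `d₀` keeps the minimiser over the closed box off the excluded face `-1/2`.
  have hdist := hnear d hd.1 (hmin (hsub hd₀))
  refine ⟨d, ⟨⟨hd.1, fun r _ => ⟨hball hdist r (Set.mem_univ r), (hmem d hd.1 r).2⟩⟩, hd.2⟩, ?_⟩
  exact hmin.on_subset hsub

end LongMemory

theorem theorem3p1 {Ω : Type*} [MeasurableSpace Ω] (μ : Measure Ω) [IsProbabilityMeasure μ]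
    {q : ℕ}
    (X : ℕ → Ω → Fin q → ℝ) (f : ℝ → Matrix (Fin q) (Fin q) ℂ)
    (hX : LongMemory.WeaklyStationary μ X) (hf : LongMemory.IsSpectralDensity μ X f)
    (G₀ : Matrix (Fin q) (Fin q) ℝ) (hG₀ : G₀.PosDef) (d₀ : Fin q → ℝ)
    (A : ℕ → Matrix (Fin q) (Fin q) ℝ) (ε : ℤ → Ω → Fin q → ℝ) (m : ℕ → ℕ)
    (hA1 : LongMemory.AssumptionA1 f G₀ d₀)
    (hA2 : LongMemory.AssumptionA2 μ X A ε)
    (hA3 : LongMemory.AssumptionA3 A)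
    (hA4 : LongMemory.AssumptionA4 m)
    (β : ℝ) (hβ : β ∈ Set.Icc (0 : ℝ) 1) (B : Set (Fin q → ℝ)) (hB : IsClosed B)
    (hd₀ : d₀ ∈ LongMemory.paramSet β B)
    (fn : (n : ℕ) → (Fin n → Fin q → ℝ) → ℝ → Matrix (Fin q) (Fin q) ℂ)
    (hfn : LongMemory.IsRateConsistent μ β m f (LongMemory.estimate X fn))
    (dhat : ℕ → Ω → Fin q → ℝ)
    (hdhat : LongMemory.IsArgminEstimator (LongMemory.paramSet β B)
      (fun n ω => LongMemory.objective n (m n) (LongMemory.estimate X fn n ω)) dhat) :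
    TendstoInMeasure μ dhat atTop (fun _ => d₀) := by
  rw [tendstoInMeasure_iff_dist]
  intro η hη
  have hopen : IsOpen (Set.univ.pi fun _ : Fin q => Set.Ioi (-1 / 2 : ℝ)) :=
    isOpen_set_pi Set.finite_univ fun _ _ => isOpen_Ioi
  obtain ⟨η₁, hη₁, hball⟩ := Metric.isOpen_iff.1 hopen d₀
    fun r _ => (hd₀.1.2 r (Set.mem_univ r)).1
  obtain ⟨κ, hκ, hsep⟩ := LongMemory.exists_objective_separated hβ
    (LongMemory.posDef_phaseMatrix hG₀ d₀) (fun r => hd₀.1.1 r (Set.mem_univ r))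
    (lt_min hη hη₁)
  obtain ⟨δ, hδ, hclose⟩ := LongMemory.exists_isCloseSpectrum hA1 β hκ
  have hfreq : Tendsto (fun n => LongMemory.fourierFreq n (m n)) atTop (𝓝 0) := by
    have h := hA4.2.const_mul (2 * Real.pi)
    rw [mul_zero] at h
    refine h.congr fun n => ?_
    rw [LongMemory.fourierFreq, mul_div_assoc]
  refine tendsto_of_tendsto_of_tendsto_of_le_of_le' tendsto_const_nhds (hfn κ hκ)
    (Eventually.of_forall fun _ => zero_le) ?_
  filter_upwards [hfreq.eventually_lt_const hδ, hfreq.eventually_lt_const one_pos,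
    hA4.1.eventually_ge_atTop 8, eventually_ge_atTop 1] with n h1 h2 h3 h4
  refine measure_mono fun ω hω => ?_
  by_contra hgood
  simp only [Set.mem_ofPred_eq, not_exists, not_and, not_le] at hgood
  obtain ⟨hex, hmin⟩ := LongMemory.exists_isMinOn_and_dist_lt hB hd₀ h4
    ((Metric.ball_subset_ball (min_le_right η η₁)).trans hball)
    (hsep n (m n) _ h4 h3 h2.le (hclose n (m n) _ h4 h1 hgood))
  obtain ⟨hmem, hm⟩ := hdhat n ω hex
  exact ((hmin _ hmem hm).trans_le (min_le_left _ _)).not_ge hω
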